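/- For a finite group $G$, a complex character $\chi$ of $G$ is multiplicity-free if $\langle\chi,\psi\rangle\le 1$ for every irreducible complex character $\psi$ of $G$. A subgroup $H\le G$ is a strong Gelfand subgroup of $G$ if for every irreducible complex character $\psi$ of $H$ the induced character $\psi\uparrow G$ is multiplicity-free. For a field $F$, let $\mathrm{Sp}_4(F)$ be the group of $4\times 4$ matrices $A$ over $F$ with $AJA^{T}=J$, where $J=\begin{pmatrix}0&-I_2\\ I_2&0\end{pmatrix}$; for a subfield $K$ of $F$, regard $\mathrm{Sp}_4(K)$ as the subgroup of matrices in $\mathrm{Sp}_4(F)$ with all entries in $K$. When $F$ is a finite field with $q$ elements we write $\mathrm{Sp}_4(q)$ for $\mathrm{Sp}_4(F)$. **Theorem.** Let $q=2^e$ with $e>1$, and let $q_0$ be such that $q=q_0^r$ for a prime $r$. Let $F$ be a field with $q$ elements and $K$ its subfield with $q_0$ elements. Then the subfield subgroup $\mathrm{Sp}_4(q_0)=\mathrm{Sp}_4(K)\le \mathrm{Sp}_4(F)=\mathrm{Sp}_4(q)$, as well as each of its conjugates in $\mathrm{Sp}_4(q)$, is not a strong Gelfand subgroup of $\mathrm{Sp}_4(q)$.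 -/

import Mathlib

namespace StrongGelfand

section Characters

variable {G : Type*} [Group G]

/-- `χ` is an irreducible complex character of `G`: the character of an irreducible
finite-dimensional complex representation of `G`. -/
def IsIrreducibleCharacter (χ : G → ℂ) : Prop :=
  ∃ (V : Type) (_ : AddCommGroup V) (_ : Module ℂ V) (_ : FiniteDimensional ℂ V)
    (ρ : Representation ℂ G V), ρ.IsIrreducible ∧ ρ.character = χ

/-- The standard inner product `⟨χ, ψ⟩ = |G|⁻¹ ∑ g, χ(g) * conj ψ(g)` of complex functions on a
finite group. -/
noncomputable def charInner [Finite G] (χ ψ : G → ℂ) : ℂ :=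
  (Nat.card G : ℂ)⁻¹ * ∑ᶠ g : G, χ g * starRingEnd ℂ (ψ g)

open scoped ComplexOrder in
/-- `χ` is multiplicity-free: `⟨χ, ψ⟩ ≤ 1` for every irreducible character `ψ` of `G`. (When `χ` is
a character these inner products are natural numbers.) -/
def IsMultiplicityFree [Finite G] (χ : G → ℂ) : Prop :=
  ∀ ψ : G → ℂ, IsIrreducibleCharacter ψ → charInner χ ψ ≤ 1

open scoped Classical in
/-- The function on `G` induced from the function `ψ` on the subgroup `H`:
`(ψ ↑ G)(g) = |H|⁻¹ ∑ ψ(x⁻¹ g x)`, over all `x ∈ G` with `x⁻¹ g x ∈ H`. -/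
noncomputable def inducedCharacter [Finite G] (H : Subgroup G) (ψ : H → ℂ) (g : G) : ℂ :=
  (Nat.card H : ℂ)⁻¹ * ∑ᶠ x : G, if h : x⁻¹ * g * x ∈ H then ψ ⟨x⁻¹ * g * x, h⟩ else 0

/-- `H` is a strong Gelfand subgroup of the finite group `G`, i.e. `(G, H)` is a strong Gelfand
pair: every irreducible character of `H` induces to a multiplicity-free character of `G`. -/
def IsStrongGelfandSubgroup [Finite G] (H : Subgroup G) : Prop :=
  ∀ ψ : H → ℂ, IsIrreducibleCharacter ψ → IsMultiplicityFree (inducedCharacter H ψ)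

end Characters

section Symplectic

/-- The symplectic group `Sp₄(F)`: the `4 × 4` matrices `A` with `A * J * Aᵀ = J`. -/
abbrev Sp4 (F : Type*) [Field F] : Type _ := Matrix.symplecticGroup (Fin 2) F

/-- The homomorphism `Sp₄(K) → Sp₄(F)` that applies a field homomorphism to the matrix entries. -/
def Sp4.map {K F : Type*} [Field K] [Field F] (f : K →+* F) : Sp4 K →* Sp4 F where
  toFun A := ⟨A.1.map f, SymplecticGroup.map_mem A.2 f⟩
  map_one' := Subtype.ext (Matrix.map_one f (map_zero f) (map_one f))
  map_mul' _ _ := Subtype.ext Matrix.map_mul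

/-- The subfield subgroup `Sp₄(K) ≤ Sp₄(F)` of a subfield `K` of `F`. -/
def subfieldSubgroup {F : Type*} [Field F] (K : Subfield F) : Subgroup (Sp4 F) :=
  (Sp4.map K.subtype).range

end Symplectic

end StrongGelfand

namespace StrongGelfand

/-! ### Multiplicity-free restriction and commuting class sums -/

section RepresentationTheory

open Module

open scoped ComplexConjugate

/-! If `H` is a strong Gelfand subgroup of `G`, Frobenius reciprocity makes every irreducible
representation of `G` multiplicity-free on `H`, so its `H`-endomorphisms commute. Sums over
`H`-conjugates act by such endomorphisms, hence commute on every representation of `G`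
(`conjSum_commute`). In the regular representation, comparing coefficients at `x * y` shows that `x
* y` is a conjugate of `y` times a conjugate of `x`, both under `H`
(`IsStrongGelfandSubgroup.exists_mul_eq`).

For `H = Sp4 K` with `K` proper, two transvections built from some `μ ∉ K` violate this
(`transvection_mul_ne`). Conjugating them by `g` handles the conjugates of `H`. -/

/-- A linear subspace containing all irreducible subrepresentations contains every
subrepresentation. -/
theorem toSubmodule_le_of_irreducible_le {G V : Type*} [Group G] [AddCommGroup V] [Module ℂ V]
    [Finite G] [FiniteDimensional ℂ V] (ρ : Representation ℂ G V) (E : Submodule ℂ V)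
    (h : ∀ σ : Subrepresentation ρ, σ.toRepresentation.IsIrreducible → σ.toSubmodule ≤ E) :
    ∀ (n : ℕ) (σ : Subrepresentation ρ), finrank ℂ σ.toSubmodule = n → σ.toSubmodule ≤ E := by
  intro n
  induction n using Nat.strong_induction_on with
  | _ n ih =>
  intro σ hσ
  by_cases h0 : σ.toSubmodule = ⊥
  · simp [h0]
  by_cases hirr : σ.toRepresentation.IsIrreducible
  · exact h σ hirr
  have hnt : Nontrivial (Subrepresentation σ.toRepresentation) := by
    refine ⟨⊥, ⊤, fun hbt => h0 ?_⟩
    have hbt' : (⊥ : Submodule ℂ σ.toSubmodule) = ⊤ := congrArg Subrepresentation.toSubmodule hbt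
    rw [Submodule.eq_bot_iff]
    intro x hx
    have : (⟨x, hx⟩ : σ.toSubmodule) ∈ (⊥ : Submodule ℂ σ.toSubmodule) := by
      rw [hbt']; trivial
    simpa using this
  obtain ⟨τ, hτb, hτt⟩ : ∃ τ : Subrepresentation σ.toRepresentation, τ ≠ ⊥ ∧ τ ≠ ⊤ := by
    by_contra! hcon
    exact hirr ⟨fun a => or_iff_not_imp_left.2 (hcon a)⟩
  let Q : Subrepresentation ρ :=
    ⟨τ.toSubmodule.map σ.toSubmodule.subtype, by
      rintro g _ ⟨w, hw, rfl⟩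
      exact ⟨_, τ.apply_mem_toSubmodule g hw, rfl⟩⟩
  have hQσ : Q.toSubmodule ≤ σ.toSubmodule := Submodule.map_subtype_le _ _
  have hQb : Q.toSubmodule ≠ ⊥ := by
    intro hq
    exact hτb (Subrepresentation.toSubmodule_injective
      (Submodule.map_injective_of_injective (Submodule.injective_subtype σ.toSubmodule)
        (hq.trans (Submodule.map_bot _).symm)))
  have hQt : Q.toSubmodule ≠ σ.toSubmodule := by
    intro hq
    refine hτt (Subrepresentation.toSubmodule_injective ?_)
    refine Submodule.map_injective_of_injective (Submodule.injective_subtype σ.toSubmodule) ?_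
    refine hq.trans ?_
    exact (Submodule.map_subtype_top _).symm
  obtain ⟨C, hC⟩ := exists_isCompl Q
  have hCi : Q.toSubmodule ⊓ C.toSubmodule = ⊥ :=
    congrArg Subrepresentation.toSubmodule hC.inf_eq_bot
  have hCs : Q.toSubmodule ⊔ C.toSubmodule = ⊤ :=
    congrArg Subrepresentation.toSubmodule hC.sup_eq_top
  -- By the modular law `R` complements `Q` in `σ`; both are proper, so induction applies to each.
  let R : Subrepresentation ρ := σ ⊓ C
  have hRσ : R.toSubmodule ≤ σ.toSubmodule := inf_le_left
  have hRt : R.toSubmodule ≠ σ.toSubmodule := by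
    intro hr
    have hσC : σ.toSubmodule ≤ C.toSubmodule := by
      rw [← hr]; exact inf_le_right
    exact hQb (le_bot_iff.1 (hCi ▸ le_inf le_rfl (hQσ.trans hσC)))
  have hsup : σ.toSubmodule ≤ Q.toSubmodule ⊔ R.toSubmodule := by
    intro x hx
    obtain ⟨q, hq, c, hc, rfl⟩ : ∃ q ∈ Q.toSubmodule, ∃ c ∈ C.toSubmodule, q + c = x :=
      Submodule.mem_sup.1 (hCs ▸ Submodule.mem_top)
    refine Submodule.add_mem_sup hq ⟨?_, hc⟩
    simpa using σ.toSubmodule.sub_mem hx (hQσ hq)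
  refine hsup.trans (sup_le ?_ ?_)
  · exact ih _ (hσ ▸ Submodule.finrank_lt_finrank_of_lt (lt_of_le_of_ne hQσ hQt)) Q rfl
  · exact ih _ (hσ ▸ Submodule.finrank_lt_finrank_of_lt (lt_of_le_of_ne hRσ hRt)) R rfl

/-- A linear subspace that contains all irreducible subrepresentations is everything. -/
theorem eq_top_of_irreducible_le {G V : Type*} [Group G] [AddCommGroup V] [Module ℂ V]
    [Finite G] [FiniteDimensional ℂ V] (ρ : Representation ℂ G V) (E : Submodule ℂ V)
    (h : ∀ σ : Subrepresentation ρ, σ.toRepresentation.IsIrreducible → σ.toSubmodule ≤ E) :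
    E = ⊤ :=
  top_le_iff.1 (toSubmodule_le_of_irreducible_le ρ E h _ ⊤ rfl)

theorem isIrreducible_of_equiv {k G V W : Type*} [Monoid G] [Field k] [AddCommGroup V] [Module k V]
    [AddCommGroup W] [Module k W] {ρ : Representation k G V} {σ : Representation k G W}
    (e : V ≃ₗ[k] W) (he : ∀ g v, e (ρ g v) = σ g (e v)) (h : ρ.IsIrreducible) :
    σ.IsIrreducible := by
  let φ : Subrepresentation ρ ≃o Subrepresentation σ :=
    { toFun := fun P => ⟨P.toSubmodule.map e.toLinearMap, by
        rintro g _ ⟨v, hv, rfl⟩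
        exact ⟨_, P.apply_mem_toSubmodule g hv, he g v⟩⟩
      invFun := fun Q => ⟨Q.toSubmodule.comap e.toLinearMap, by
        intro g v hv
        have := Q.apply_mem_toSubmodule g hv
        simpa [he] using this⟩
      left_inv := fun P => Subrepresentation.toSubmodule_injective
        (Submodule.comap_map_eq_of_injective e.injective _)
      right_inv := fun Q => Subrepresentation.toSubmodule_injective
        (Submodule.map_comap_eq_of_surjective e.surjective _)
      map_rel_iff' := by
        intro P Q
        exact Submodule.map_le_map_iff_of_injective e.injective _ _ }
  exact φ.isSimpleOrder_iff.1 h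

/-- Transport to `ℂⁿ` removes the universe restriction in `IsIrreducibleCharacter`. -/
theorem isIrreducibleCharacter_of_isIrreducible {G V : Type*} [Group G] [AddCommGroup V]
    [Module ℂ V] [FiniteDimensional ℂ V] {ρ : Representation ℂ G V} (h : ρ.IsIrreducible) :
    IsIrreducibleCharacter ρ.character := by
  let e : V ≃ₗ[ℂ] (Fin (finrank ℂ V) → ℂ) := (finBasis ℂ V).equivFun
  let σ : Representation ℂ G (Fin (finrank ℂ V) → ℂ) :=
    (e.conjAlgEquiv ℂ : End ℂ V →* End ℂ (Fin (finrank ℂ V) → ℂ)).comp ρ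
  have hσ : ∀ g, σ g = e.conj (ρ g) := fun g => rfl
  refine ⟨Fin (finrank ℂ V) → ℂ, inferInstance, inferInstance, inferInstance, σ,
    isIrreducible_of_equiv e (fun g v => ?_) h, ?_⟩
  · simp [hσ, LinearEquiv.conj_apply_apply]
  · ext g
    simp [Representation.character, hσ, LinearMap.trace_conj']

/-- `ρ g` has finite order, so it is diagonalizable with roots of unity as eigenvalues, for which
conjugate and inverse agree. -/
theorem conj_character {G V : Type*} [Group G] [Finite G] [AddCommGroup V] [Module ℂ V]
    [FiniteDimensional ℂ V] (ρ : Representation ℂ G V) (g : G) :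
    conj (ρ.character g) = ρ.character g⁻¹ := by
  have hpow : (ρ g) ^ Nat.card G = 1 := by rw [← map_pow, pow_card_eq_one', map_one]
  have hss : Module.End.IsSemisimple (ρ g) := by
    refine Module.End.isSemisimple_of_squarefree_aeval_eq_zero
      (p := Polynomial.X ^ Nat.card G - 1) ?_ ?_
    · have := Polynomial.X_pow_sub_one_separable_iff (F := ℂ) (n := Nat.card G)
      exact (this.2 (by exact_mod_cast Nat.card_pos.ne')).squarefree
    · simp [hpow]
  have hint : DirectSum.IsInternal (Module.End.eigenspace (ρ g)) :=
    DirectSum.isInternal_submodule_of_iSupIndep_of_iSup_eq_top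
      (Module.End.eigenspaces_iSupIndep (ρ g)) hss.iSup_eigenspace_eq_top
  have hfin : {μ | Module.End.eigenspace (ρ g) μ ≠ ⊥}.Finite :=
    WellFoundedGT.finite_ne_bot_of_iSupIndep hint.submodule_iSupIndep
  have hinv : ∀ v, ρ g⁻¹ (ρ g v) = v := fun v => by
    rw [← Module.End.mul_apply, ← map_mul]; simp
  have hmem : ∀ μ v, v ∈ Module.End.eigenspace (ρ g) μ → ρ g v = μ • v :=
    fun μ v hv => Module.End.mem_eigenspace_iff.1 hv
  have hmem' : ∀ μ v, v ∈ Module.End.eigenspace (ρ g) μ → ρ g⁻¹ v = μ⁻¹ • v := by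
    intro μ v hv
    have h1 := hmem μ v hv
    have h2 : v = μ • ρ g⁻¹ v := by rw [← map_smul, ← h1, hinv]
    by_cases hμ : μ = 0
    · rw [hμ, zero_smul] at h2
      simp [h2]
    · rw [eq_inv_smul_iff₀ hμ, ← h2]
  have hmaps : ∀ μ, Set.MapsTo (ρ g) (Module.End.eigenspace (ρ g) μ)
      (Module.End.eigenspace (ρ g) μ) := by
    intro μ v hv
    rw [hmem μ v hv]
    exact Submodule.smul_mem _ _ hv
  have hmaps' : ∀ μ, Set.MapsTo (ρ g⁻¹) (Module.End.eigenspace (ρ g) μ)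
      (Module.End.eigenspace (ρ g) μ) := by
    intro μ v hv
    rw [hmem' μ v hv]
    exact Submodule.smul_mem _ _ hv
  unfold Representation.character
  rw [LinearMap.trace_eq_sum_trace_restrict' hint hfin hmaps,
    LinearMap.trace_eq_sum_trace_restrict' hint hfin hmaps', map_sum]
  refine Finset.sum_congr rfl fun μ hμ => ?_
  have hμ' : Module.End.eigenspace (ρ g) μ ≠ ⊥ := by simpa using hμ
  have e1 : (ρ g).restrict (hmaps μ) = μ • LinearMap.id := by
    ext v
    exact hmem μ v v.2
  have e2 : (ρ g⁻¹).restrict (hmaps' μ) = μ⁻¹ • LinearMap.id := by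
    ext v
    exact hmem' μ v v.2
  have hμ1 : μ ^ Nat.card G = 1 := by
    obtain ⟨v, hv, hv0⟩ := Submodule.exists_mem_ne_zero_of_ne_bot hμ'
    have h3 : ∀ n : ℕ, ((ρ g) ^ n) v = μ ^ n • v := by
      intro n
      induction n with
      | zero => simp
      | succ n ih => rw [pow_succ, Module.End.mul_apply, hmem μ v hv, map_smul, ih, smul_smul,
          pow_succ, mul_comm]
    have h4 := h3 (Nat.card G)
    rw [hpow] at h4
    have h5 : (μ ^ Nat.card G - 1) • v = 0 := by
      rw [sub_smul, ← h4]; simp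
    exact sub_eq_zero.1 ((smul_eq_zero.1 h5).resolve_right hv0)
  have hnorm : ‖μ‖ = 1 := Complex.norm_eq_one_of_pow_eq_one hμ1 Nat.card_pos.ne'
  rw [e1, e2, (LinearMap.trace ℂ _).map_smul, (LinearMap.trace ℂ _).map_smul, LinearMap.trace_id,
    smul_eq_mul, smul_eq_mul, map_mul, Complex.inv_eq_conj hnorm, Complex.conj_natCast]

/-- Frobenius reciprocity for class functions. -/
theorem charInner_inducedCharacter {G : Type*} [Group G] [Finite G] (H : Subgroup G) (ψ : H → ℂ)
    (χ : G → ℂ) (hχ : ∀ x g, χ (x * g * x⁻¹) = χ g) :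
    charInner (inducedCharacter H ψ) χ = charInner ψ (fun h => χ h) := by
  classical
  have := Fintype.ofFinite G
  have := Fintype.ofFinite H
  unfold charInner inducedCharacter
  simp only [finsum_eq_sum_of_fintype]
  have key : ∀ x : G, ∑ g : G, (if h : x⁻¹ * g * x ∈ H then ψ ⟨x⁻¹ * g * x, h⟩ else 0) *
      conj (χ g) = ∑ h : H, ψ h * conj (χ h) := by
    intro x
    rw [← Equiv.sum_comp (MulAut.conj x).toEquiv]
    have e : ∀ g : G, x⁻¹ * (x * g * x⁻¹) * x = g := fun g => by group
    simp only [MulEquiv.toEquiv_eq_coe, MulEquiv.coe_toEquiv, MulAut.conj_apply, hχ, e]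
    rw [← Finset.sum_subset (Finset.subset_univ (Finset.univ.filter (· ∈ H)))]
    · rw [Finset.sum_subtype (p := (· ∈ H)) _ (by simp)]
      exact Finset.sum_congr rfl fun h _ => by simp [h.2]
    · intro g _ hg
      simp at hg
      simp [hg]
  simp_rw [mul_assoc (Nat.card H : ℂ)⁻¹, Finset.sum_mul, ← Finset.mul_sum]
  rw [Finset.sum_comm]
  simp_rw [key]
  have hG : (Nat.card G : ℂ) ≠ 0 := by simp
  rw [Finset.sum_const, Finset.card_univ, ← Nat.card_eq_fintype_card, nsmul_eq_mul]
  field_simp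

open scoped ComplexOrder in
theorem finrank_intertwiningMap_le_one {G V W : Type*} [Group G] [Finite G] {H : Subgroup G}
    (hH : IsStrongGelfandSubgroup H) [AddCommGroup V] [Module ℂ V] [FiniteDimensional ℂ V]
    [AddCommGroup W] [Module ℂ W] [FiniteDimensional ℂ W] {ρ : Representation ℂ G V}
    (hρ : ρ.IsIrreducible) {τ : Representation ℂ H W} (hτ : τ.IsIrreducible) :
    finrank ℂ (Representation.IntertwiningMap τ (ρ.comp H.subtype)) ≤ 1 := by
  have := Fintype.ofFinite H
  have hinv : Invertible (Nat.card H : ℂ) := invertibleOfNonzero (by simp)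
  have h := hH _ (isIrreducibleCharacter_of_isIrreducible hτ) _
    (isIrreducibleCharacter_of_isIrreducible hρ)
  rw [charInner_inducedCharacter H _ _ (fun x g => ρ.char_conj g x)] at h
  have e : charInner τ.character (fun h : H => ρ.character h) =
      finrank ℂ (Representation.IntertwiningMap τ (ρ.comp H.subtype)) := by
    rw [← Representation.card_inv_mul_sum_char_mul_char_eq_finrank]
    unfold charInner
    rw [finsum_eq_sum_of_fintype, ← Equiv.sum_comp (Equiv.inv H)]
    congr 1
    refine Finset.sum_congr rfl fun x _ => ?_
    rw [conj_character, mul_comm]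
    simp [Representation.character]
  rw [e] at h
  exact_mod_cast h

/-- The endomorphisms of a multiplicity-free representation commute. -/
theorem comp_comm_of_finrank_intertwiningMap_le_one {H V : Type*} [Group H] [Finite H]
    [AddCommGroup V] [Module ℂ V] [FiniteDimensional ℂ V] (ρ : Representation ℂ H V)
    (hρ : ∀ σ : Subrepresentation ρ, σ.toRepresentation.IsIrreducible →
      finrank ℂ (Representation.IntertwiningMap σ.toRepresentation ρ) ≤ 1)
    (a b : End ℂ V) (ha : ∀ h, Commute a (ρ h)) (hb : ∀ h, Commute b (ρ h)) : Commute a b := by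
  have key : LinearMap.ker (a * b - b * a) = ⊤ := by
    refine eq_top_of_irreducible_le ρ _ fun σ hσ => ?_
    -- The inclusion `ι` spans the space of intertwiners from `σ`, so `c ∘ ι` is a multiple of it.
    have scalar : ∀ c : End ℂ V, (∀ h, Commute c (ρ h)) →
        ∃ t : ℂ, ∀ v ∈ σ.toSubmodule, c v = t • v := by
      intro c hc
      let ι : Representation.IntertwiningMap σ.toRepresentation ρ :=
        ⟨σ.toSubmodule.subtype, fun g => rfl⟩
      let cι : Representation.IntertwiningMap σ.toRepresentation ρ :=
        ⟨c ∘ₗ σ.toSubmodule.subtype, fun g => by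
          ext v
          exact congrArg (fun f : End ℂ V => f v) (hc g).eq⟩
      have hι : ι ≠ 0 := by
        intro h0
        have hb : (⊥ : Subrepresentation σ.toRepresentation) = ⊤ := by
          refine Subrepresentation.toSubmodule_injective (Submodule.ext fun v => ?_)
          have : (v : V) = 0 := congrArg (fun f : Representation.IntertwiningMap
            σ.toRepresentation ρ => f v) h0
          have hv : v = 0 := Subtype.ext this
          rw [hv]
          exact iff_of_true (Submodule.zero_mem _) (Submodule.zero_mem _)
        exact hσ.toNontrivial.exists_pair_ne.elim fun x ⟨y, hxy⟩ =>
          hxy ((le_antisymm (hb ▸ le_top) bot_le).trans (le_antisymm (hb ▸ le_top) bot_le).symm)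
      obtain ⟨w, hw⟩ := finrank_le_one_iff.1 (hρ σ hσ)
      obtain ⟨r, hr⟩ := hw ι
      obtain ⟨s, hs⟩ := hw cι
      have hr0 : r ≠ 0 := by
        rintro rfl
        exact hι (hr.symm.trans (zero_smul _ _))
      obtain ⟨t, ht⟩ : ∃ t : ℂ, t • ι = cι :=
        ⟨s * r⁻¹, by rw [← hr, smul_smul, mul_assoc, inv_mul_cancel₀ hr0, mul_one, hs]⟩
      refine ⟨t, fun v hv => ?_⟩
      exact (congrArg (fun f : Representation.IntertwiningMap
            σ.toRepresentation ρ => f ⟨v, hv⟩) ht).symm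
    obtain ⟨s, hs⟩ := scalar a ha
    obtain ⟨t, ht⟩ := scalar b hb
    intro v hv
    simp [hs v hv, ht v hv, smul_smul, mul_comm]
  exact sub_eq_zero.1 (LinearMap.ker_eq_top.1 key)

/-- The sum of the images of the `H`-conjugates of `x`. -/
noncomputable def conjSum {G V : Type*} [Group G] [AddCommGroup V] [Module ℂ V]
    (ρ : Representation ℂ G V) (H : Subgroup G) [Fintype H] (x : G) : End ℂ V :=
  ∑ h : H, ρ (h * x * (h : G)⁻¹)

theorem commute_conjSum {G V : Type*} [Group G] [AddCommGroup V] [Module ℂ V]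
    (ρ : Representation ℂ G V) (H : Subgroup G) [Fintype H] (x : G) (k : H) :
    Commute (conjSum ρ H x) (ρ.comp H.subtype k) := by
  show _ * _ = _ * _
  unfold conjSum
  rw [Finset.sum_mul, Finset.mul_sum, ← Equiv.sum_comp (Equiv.mulLeft k)]
  refine Finset.sum_congr rfl fun h _ => ?_
  simp [← map_mul, mul_assoc]

theorem conjSum_commute {G V : Type*} [Group G] [Finite G] [AddCommGroup V] [Module ℂ V]
    [FiniteDimensional ℂ V] (ρ : Representation ℂ G V) {H : Subgroup G} [Fintype H]
    (hH : IsStrongGelfandSubgroup H) (x y : G) :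
    Commute (conjSum ρ H x) (conjSum ρ H y) := by
  have key : LinearMap.ker (conjSum ρ H x * conjSum ρ H y - conjSum ρ H y * conjSum ρ H x) = ⊤ := by
    refine eq_top_of_irreducible_le ρ _ fun σ hσ => ?_
    have hc : Commute (conjSum σ.toRepresentation H x) (conjSum σ.toRepresentation H y) :=
      comp_comm_of_finrank_intertwiningMap_le_one (σ.toRepresentation.comp H.subtype)
        (fun τ hτ => finrank_intertwiningMap_le_one hH hσ hτ) _ _
        (commute_conjSum _ H x) (commute_conjSum _ H y)
    have hcoe : ∀ z (v : σ.toSubmodule),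
        (conjSum σ.toRepresentation H z v : V) = conjSum ρ H z v := by
      intro z v
      simp only [conjSum, LinearMap.sum_apply, AddSubmonoidClass.coe_finsetSum]
      rfl
    intro v hv
    have := congrArg (fun f : End ℂ σ.toSubmodule => (f ⟨v, hv⟩ : V)) hc.eq
    simp only [Module.End.mul_apply, hcoe] at this
    simp [this]
  exact sub_eq_zero.1 (LinearMap.ker_eq_top.1 key)

/-- Class sums of a strong Gelfand subgroup commute; in particular their supports do. -/
theorem IsStrongGelfandSubgroup.exists_mul_eq {G : Type*} [Group G] [Finite G] {H : Subgroup G}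
    (hH : IsStrongGelfandSubgroup H) (x y : G) :
    ∃ h ∈ H, ∃ k ∈ H, x * y = (k * y * k⁻¹) * (h * x * h⁻¹) := by
  classical
  have := Fintype.ofFinite G
  by_contra! hcon
  have hcomm := (conjSum_commute (Representation.leftRegular ℂ G) hH x y).eq
  have h1 := congrArg (fun f : End ℂ (MonoidAlgebra ℂ G) =>
    (f (MonoidAlgebra.single 1 1)).coeff (x * y)) hcomm
  simp only [conjSum, Finset.sum_mul_sum, ← map_mul, LinearMap.sum_apply,
    Representation.ofMulAction_single, smul_eq_mul, mul_one] at h1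
  simp only [MonoidAlgebra.coeff_sum, Finsupp.finsetSum_apply, MonoidAlgebra.coeff_single,
    Finsupp.single_apply] at h1
  have hr : ∀ k h : H, ¬ ((k : G) * y * (k : G)⁻¹ * (h * x * (h : G)⁻¹) = x * y) :=
    fun k h e => hcon h h.2 k k.2 e.symm
  simp only [hr, if_false, Finset.sum_const_zero] at h1
  -- The coefficient counts pairs `(h, k)`, and `h = k = 1` is one of them.
  have h2 : (∑ h : H, ∑ k : H,
      if (h : G) * x * (h : G)⁻¹ * (k * y * (k : G)⁻¹) = x * y then 1 else 0 : ℕ) = 0 := by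
    exact_mod_cast h1
  simp only [Finset.sum_eq_zero_iff, Finset.mem_univ, true_imp_iff] at h2
  simpa using h2 1 1

end RepresentationTheory

/-! ### Transvections over a subfield -/

section Symplectic

open Matrix

/-- The symplectic transvection `w ↦ w + c (vᵀ J w) v`. -/
def transvection {F : Type*} [Field F] (v : Fin 2 ⊕ Fin 2 → F) (c : F) : Sp4 F :=
  ⟨1 + c • (vecMulVec v v * J (Fin 2) F), by
    rw [SymplecticGroup.mem_iff]
    ext i j
    rcases i with i | i <;> rcases j with j | j <;> fin_cases i <;> fin_cases j <;>
      simp [J, Matrix.mul_apply, vecMulVec_apply, Fintype.sum_sum_type, Fin.sum_univ_two,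
        Matrix.one_apply, Matrix.fromBlocks] <;> ring⟩

theorem conj_transvection {F : Type*} [Field F] (A : Sp4 F) (v : Fin 2 ⊕ Fin 2 → F) (c : F) :
    A * transvection v c * A⁻¹ = transvection (A.1 *ᵥ v) c := by
  rw [mul_inv_eq_iff_eq_mul]
  have hA : A.1ᵀ * J (Fin 2) F * A.1 = J (Fin 2) F := SymplecticGroup.mem_iff'.1 A.2
  refine Subtype.ext ?_
  have e : vecMulVec (A.1 *ᵥ v) (A.1 *ᵥ v) = A.1 * vecMulVec v v * A.1ᵀ := by
    rw [Matrix.mul_vecMulVec, Matrix.vecMulVec_mul, Matrix.vecMul_transpose]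
  show A.1 * (1 + c • (vecMulVec v v * J (Fin 2) F)) =
    (1 + c • (vecMulVec (A.1 *ᵥ v) (A.1 *ᵥ v) * J (Fin 2) F)) * A.1
  rw [e, mul_add, add_mul, mul_one, one_mul, Matrix.mul_smul, Matrix.smul_mul]
  congr 2
  simp only [Matrix.mul_assoc] at hA ⊢
  rw [hA]

theorem transvection_mul_apply {F : Type*} [Field F] (u v : Fin 2 ⊕ Fin 2 → F) (c d : F) :
    (transvection u c * transvection v d).1 =
      1 + (c • vecMulVec u u + d • vecMulVec v v +
        (c * d * (u ⬝ᵥ J (Fin 2) F *ᵥ v)) • vecMulVec u v) * J (Fin 2) F := by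
  show (1 + c • (vecMulVec u u * J (Fin 2) F)) * (1 + d • (vecMulVec v v * J (Fin 2) F)) = _
  have e : vecMulVec u u * J (Fin 2) F * vecMulVec v v =
      (u ⬝ᵥ J (Fin 2) F *ᵥ v) • vecMulVec u v := by
    rw [Matrix.mul_assoc, Matrix.mul_vecMulVec, Matrix.vecMulVec_mul_vecMulVec]
    ext i j
    simp [vecMulVec_apply]
    ring
  have e' : c • (vecMulVec u u * J (Fin 2) F) * d • (vecMulVec v v * J (Fin 2) F) =
      (c * d * (u ⬝ᵥ J (Fin 2) F *ᵥ v)) • vecMulVec u v * J (Fin 2) F := by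
    rw [Matrix.smul_mul, Matrix.mul_smul, ← Matrix.mul_assoc, e]
    simp only [Matrix.smul_mul, smul_smul, mul_assoc]
  rw [mul_add, add_mul, add_mul, e']
  simp only [add_mul, one_mul, mul_one, Matrix.smul_mul]
  abel

theorem transvection_mul_eq_iff {F : Type*} [Field F] {u v u' v' : Fin 2 ⊕ Fin 2 → F}
    {c d c' d' : F} :
    transvection u c * transvection v d = transvection u' c' * transvection v' d' ↔
      c • vecMulVec u u + d • vecMulVec v v + (c * d * (u ⬝ᵥ J (Fin 2) F *ᵥ v)) • vecMulVec u v =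
      c' • vecMulVec u' u' + d' • vecMulVec v' v' +
        (c' * d' * (u' ⬝ᵥ J (Fin 2) F *ᵥ v')) • vecMulVec u' v' := by
  rw [Subtype.ext_iff, transvection_mul_apply, transvection_mul_apply, add_right_inj]
  exact (isUnit_det_J (Fin 2) F |> (Matrix.isUnit_iff_isUnit_det _).2).mul_left_inj

theorem apply_mem_of_mem_subfieldSubgroup {F : Type*} [Field F] {K : Subfield F} {A : Sp4 F}
    (hA : A ∈ subfieldSubgroup K) (i j : Fin 2 ⊕ Fin 2) : A.1 i j ∈ K := by
  obtain ⟨B, rfl⟩ := hA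
  exact (B.1 i j).2

/-- `1` and `μ` are linearly independent over `K`. -/
theorem Subfield.eq_and_eq_of_add_mul_eq {F : Type*} [Field F] {K : Subfield F} {μ : F}
    (hμ : μ ∉ K) {a b c d : F} (ha : a ∈ K) (hb : b ∈ K) (hc : c ∈ K) (hd : d ∈ K)
    (h : a + μ * b = c + μ * d) : a = c ∧ b = d := by
  have hbd : b = d := by
    by_contra hne
    have hne' : b - d ≠ 0 := sub_ne_zero.2 hne
    refine hμ ?_
    have : μ = (c - a) / (b - d) := by
      rw [eq_div_iff hne']
      linear_combination h
    rw [this]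
    exact K.div_mem (K.sub_mem hc ha) (K.sub_mem hb hd)
  subst hbd
  exact ⟨by linear_combination h, rfl⟩

/-- Write `e₁, e₂, f₁, f₂` for the standard basis, `p = A e₁` and `n = B f₁ + μ B e₂`. The matrix
equation determines enough of `p` and `n` to force `B f₁` and `B e₂` to pair nontrivially, although
`f₁` and `e₂` are orthogonal. -/
theorem transvection_mul_ne {F : Type*} [Field F] [CharP F 2] {K : Subfield F} {μ : F} (hμ : μ ∉ K)
    {A B : Sp4 F} (hA : A ∈ subfieldSubgroup K) (hB : B ∈ subfieldSubgroup K) :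
    transvection (Sum.elim ![1, 0] ![0, 0]) μ * transvection (Sum.elim ![0, μ] ![1, 0]) 1 ≠
      (B * transvection (Sum.elim ![0, μ] ![1, 0]) 1 * B⁻¹) *
        (A * transvection (Sum.elim ![1, 0] ![0, 0]) μ * A⁻¹) := by
  rw [conj_transvection, conj_transvection]
  intro h
  rw [transvection_mul_eq_iff] at h
  have hμ0 : μ ≠ 0 := fun h0 => hμ (h0 ▸ K.zero_mem)
  obtain ⟨p, hp⟩ : ∃ p, p = A.1 *ᵥ Sum.elim ![1, 0] ![0, 0] := ⟨_, rfl⟩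
  obtain ⟨n, hn⟩ : ∃ n, n = B.1 *ᵥ Sum.elim ![0, μ] ![1, 0] := ⟨_, rfl⟩
  rw [← hp, ← hn] at h
  have hpK : ∀ i, p i ∈ K := by
    intro i
    have : p i = A.1 i (Sum.inl 0) := by
      simp [hp, mulVec, dotProduct, Fintype.sum_sum_type]
    rw [this]
    exact apply_mem_of_mem_subfieldSubgroup hA i _
  have hni : ∀ i, n i = B.1 i (Sum.inr 0) + μ * B.1 i (Sum.inl 1) := by
    intro i
    simp [hn, mulVec, dotProduct, Fintype.sum_sum_type]
    ring
  have hBK := apply_mem_of_mem_subfieldSubgroup hB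
  have hBJ := congrFun (congrFun (SymplecticGroup.mem_iff'.1 B.2) (Sum.inr 0)) (Sum.inl 1)
  simp [J, Matrix.mul_apply, Fintype.sum_sum_type, Matrix.one_apply, Matrix.fromBlocks,
    CharTwo.neg_eq] at hBJ
  generalize n ⬝ᵥ J (Fin 2) F *ᵥ p = s at h
  have hM := fun i j => congrFun (congrFun h i) j
  simp [J, dotProduct, mulVec, Fintype.sum_sum_type, Matrix.one_apply, Matrix.fromBlocks,
    CharTwo.neg_eq, vecMulVec_apply] at hM
  obtain ⟨⟨⟨⟨m00, -⟩, m02, -⟩, ⟨m10, -⟩, m12, -⟩, ⟨⟨m20, -⟩, m22, -⟩, ⟨m30, -⟩, m32, -⟩ := hM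
  -- The minor on the `e₁, f₁` coordinates is `μ` on the left and `μ` times the square of this
  -- determinant on the right.
  have hD : n (Sum.inl 0) * p (Sum.inr 0) - n (Sum.inr 0) * p (Sum.inl 0) ≠ 0 := by
    intro hD
    refine hμ0 ?_
    have hdet : μ * 1 - μ * 0 =
        μ * (n (Sum.inl 0) * p (Sum.inr 0) - n (Sum.inr 0) * p (Sum.inl 0)) ^ 2 := by
      linear_combination congr($m00 * $m22) - congr($m02 * $m20)
    rw [hD] at hdet
    simpa using hdet
  have aux : ∀ α β : F, α * n (Sum.inl 0) + (μ * β + μ * s * α) * p (Sum.inl 0) = 0 →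
      α * n (Sum.inr 0) + (μ * β + μ * s * α) * p (Sum.inr 0) = 0 → α = 0 ∧ β = 0 := by
    intro α β h0 h2
    have hα : α = 0 := by
      refine (mul_eq_zero.1 ?_).resolve_right hD
      linear_combination h0 * p (Sum.inr 0) - h2 * p (Sum.inl 0)
    subst hα
    refine ⟨rfl, (mul_eq_zero.1 ((mul_eq_zero.1 ?_).resolve_right hD)).resolve_left hμ0⟩
    linear_combination h2 * n (Sum.inl 0) - h0 * n (Sum.inr 0)
  -- On the left, the `f₂` row vanishes, and so does the `e₂` row minus `μ` times the `f₁` row.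
  obtain ⟨n3, -⟩ := aux (n (Sum.inr 1)) (p (Sum.inr 1)) (by linear_combination -m30)
    (by linear_combination -m32)
  obtain ⟨-, p1⟩ := aux (n (Sum.inl 1) - μ * n (Sum.inr 0)) (p (Sum.inl 1) - μ * p (Sum.inr 0))
    (by linear_combination μ * m20 - m10) (by linear_combination μ * m22 - m12)
  obtain ⟨-, p2⟩ := Subfield.eq_and_eq_of_add_mul_eq hμ (hpK (Sum.inl 1)) K.zero_mem K.zero_mem
    (hpK (Sum.inr 0)) (by linear_combination p1)
  rw [← p2] at m02 m22
  have n2 : n (Sum.inr 0) = 1 := by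
    have : (n (Sum.inr 0) - 1) ^ 2 = 0 := by
      linear_combination -m22 + (1 - n (Sum.inr 0)) * CharTwo.two_eq_zero (R := F)
    exact sub_eq_zero.1 (pow_eq_zero_iff two_ne_zero |>.1 this)
  have n0 : n (Sum.inl 0) = μ := by
    rw [n2] at m02
    linear_combination -m02
  -- Splitting `n` along `1, μ` recovers the columns `B f₁` and `B e₂`.
  have coords : ∀ i, ∀ c ∈ K, ∀ d ∈ K, n i = c + μ * d →
      B.1 i (Sum.inr 0) = c ∧ B.1 i (Sum.inl 1) = d := fun i c hc d hd hi =>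
    Subfield.eq_and_eq_of_add_mul_eq hμ (hBK _ _) (hBK _ _) hc hd ((hni i).symm.trans hi)
  obtain ⟨b00, b01⟩ := coords _ 0 K.zero_mem 1 K.one_mem (n0.trans (by ring))
  obtain ⟨b20, b21⟩ := coords _ 1 K.one_mem 0 K.zero_mem (n2.trans (by ring))
  obtain ⟨b30, b31⟩ := coords _ 0 K.zero_mem 0 K.zero_mem (n3.trans (by ring))
  rw [b00, b01, b20, b21, b30, b31] at hBJ
  simp at hBJ

theorem not_isStrongGelfandSubgroup_map_conj {F : Type*} [Field F] [Finite F] [CharP F 2]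
    {K : Subfield F} (hK : K ≠ ⊤) (g : Sp4 F) :
    ¬ IsStrongGelfandSubgroup ((subfieldSubgroup K).map (MulAut.conj g).toMonoidHom) := by
  intro hG
  obtain ⟨μ, -, hμ⟩ := SetLike.exists_of_lt (lt_top_iff_ne_top.2 hK)
  obtain ⟨_, ⟨A, hA, rfl⟩, _, ⟨B, hB, rfl⟩, h⟩ := hG.exists_mul_eq
    (MulAut.conj g (transvection (Sum.elim ![1, 0] ![0, 0]) μ))
    (MulAut.conj g (transvection (Sum.elim ![0, μ] ![1, 0]) 1))
  simp only [MulEquiv.toMonoidHom_eq_coe, MonoidHom.coe_coe, ← map_mul, ← map_inv] at h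
  exact transvection_mul_ne hμ hA hB ((MulAut.conj g).injective h)

end Symplectic

end StrongGelfand

theorem mainTheorem6 (q q₀ e r : ℕ) (he : 1 < e) (hq : q = 2 ^ e) (hr : r.Prime)
    (hqr : q = q₀ ^ r) (F : Type*) [Field F] [Finite F] (hF : Nat.card F = q)
    (K : Subfield F) (hK : Nat.card K = q₀) (g : StrongGelfand.Sp4 F) :
    ¬ StrongGelfand.IsStrongGelfandSubgroup
      ((StrongGelfand.subfieldSubgroup K).map (MulAut.conj g).toMonoidHom) := by
  have h2 : (2 : F) = 0 := by
    have h := Fintype.ofFinite F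
    have hc : ((Nat.card F : ℕ) : F) = 0 := by
      rw [Nat.card_eq_fintype_card]
      exact Nat.cast_card_eq_zero F
    rw [hF, hq, Nat.cast_pow] at hc
    exact_mod_cast pow_eq_zero_iff (by omega) |>.1 hc
  have : CharP F 2 := CharTwo.of_one_ne_zero_of_two_eq_zero one_ne_zero h2
  refine StrongGelfand.not_isStrongGelfandSubgroup_map_conj ?_ g
  rintro rfl
  -- If `K = ⊤` then `q = q ^ r`, impossible for `r` prime and `q > 1`.
  have hq₀ : q₀ = q := by
    rw [← hK, ← hF]
    exact Nat.card_congr Subfield.topEquiv.toEquiv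
  have hq1 : 1 < q := hq ▸ Nat.one_lt_two_pow (by omega)
  rw [hq₀] at hqr
  have := (Nat.pow_right_injective hq1).eq_iff (a := 1) (b := r) |>.1 (by simpa using hqr)
  exact hr.one_lt.ne this
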